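/- Conventions. For topological spaces $S,T$ let $B_0(S,T)$ be the set of continuous maps $S\to T$, and for an ordinal $0<\alpha<\omega_1$ let $B_\alpha(S,T)$ be the set of all maps $f:S\to T$ for which there is a sequence $f_n\in\bigcup_{\xi<\alpha}B_\xi(S,T)$ with $f_n(s)\to f(s)$ for every $s\in S$. A triple $(X,Y,Z)$ of topological spaces is a *Rudin $\alpha$-triple* if every map $f:X\times Y\to Z$ such that $x\mapsto f(x,y)$ is continuous for every $y\in Y$, and such that the set $\{x\in X: f(x,\cdot)\in B_\alpha(Y,Z)\}$ is dense in $X$, belongs to $B_{\alpha+1}(X\times Y,Z)$. An *equiconnected space* is a pair $(Z,\lambda)$ of a topological space $Z$ and a continuous map $\lambda:Z\times Z\times[0,1]\to Z$ with $\lambda(x,y,0)=x$, $\lambda(x,y,1)=y$ and $\lambda(x,x,t)=x$ for all $x,y\in Z$, $t\in[0,1]$. A topological space $X$ is a *strong PP-space* if for every dense set $D\subseteq X$ there are a sequence $((\varphi_{i,n}:i\in I_n))_{n=1}^\infty$ of locally finite partitions of unity on $X$ and a sequence $((x_{i,n}:i\in I_n))_{n=1}^\infty$ of families of points of $D$ such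 that for every $x\in X$ and every open $U\ni x$ there is $n_0$ such that, for all $n\ge n_0$ and $i\in I_n$, $\varphi_{i,n}(x)\neq 0$ implies $x_{i,n}\in U$. A topological space $X$ is *strongly countably dimensional* if $X=\bigcup_{n=1}^\infty X_n$ for some closed sets $X_n\subseteq X$ with $\dim X_n<n$ for every $n$, where $\dim$ is the Čech–Lebesgue covering dimension: $\dim S\le m$ means that every finite cover of $S$ by co-zero sets has a finite refinement that is again a cover by co-zero sets and in which every point of $S$ lies in at most $m+1$ members. **Theorem.** Let $X$ be a Hausdorff paracompact strongly countably dimensional strong PP-space, $Y$ a topological space, $(Z,\lambda)$ an equiconnected space, and $0\le\alpha<\omega_1$. Then $(X,Y,Z)$ is a Rudin $\alpha$-triple. -/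

import Mathlib

open Set Filter Topology
open scoped Ordinal

universe u v w

/-- `f : X → Y` belongs to the Baire class `α`: class `0` consists of the continuous maps, and for
`α > 0` the class `α` consists of the pointwise limits of sequences of maps, each of which belongs
to some class `ξ < α`. -/
inductive IsBaireClass {X : Type u} {Y : Type v} [TopologicalSpace X] [TopologicalSpace Y] :
    Ordinal.{0} → (X → Y) → Prop
  | zero (f : X → Y) (hf : Continuous f) : IsBaireClass 0 f
  | limit (α : Ordinal.{0}) (hα : 0 < α) (f : X → Y) (g : ℕ → X → Y) (ξ : ℕ → Ordinal.{0})
      (hξ : ∀ n, ξ n < α) (hg : ∀ n, IsBaireClass (ξ n) (g n))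
      (hlim : ∀ x, Tendsto (fun n => g n x) atTop (𝓝 (f x))) : IsBaireClass α f

/-- `f ∈ C B̄_α (X × Y, Z)`: `f` is continuous in the first variable, and the set of those `x` for
which `f (x, ·)` is of Baire class `α` is dense in `X`. -/
def IsVerticallyNearlyBaire {X : Type u} {Y : Type v} {Z : Type w}
    [TopologicalSpace X] [TopologicalSpace Y] [TopologicalSpace Z]
    (α : Ordinal.{0}) (f : X × Y → Z) : Prop :=
  (∀ y : Y, Continuous fun x : X => f (x, y)) ∧
    Dense {x : X | IsBaireClass α fun y : Y => f (x, y)}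

/-- `(X, Y, Z)` is a Rudin `α`-triple: `C B̄_α (X × Y, Z) ⊆ B_{α+1} (X × Y, Z)`. -/
def IsRudinTriple (α : Ordinal.{0}) (X : Type u) (Y : Type v) (Z : Type w)
    [TopologicalSpace X] [TopologicalSpace Y] [TopologicalSpace Z] : Prop :=
  ∀ f : X × Y → Z, IsVerticallyNearlyBaire α f → IsBaireClass (α + 1) f

/-- `(Z, lam)` is an equiconnected space. -/
structure IsEquiconnected {Z : Type w} [TopologicalSpace Z]
    (lam : Z × Z × unitInterval → Z) : Prop where
  continuous : Continuous lam
  map_zero : ∀ x y : Z, lam (x, y, 0) = x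
  map_one : ∀ x y : Z, lam (x, y, 1) = y
  map_self : ∀ (x : Z) (t : unitInterval), lam (x, x, t) = x

/-- Strong PP-spaces. In `PartitionOfUnity` the family of supports is locally finite and the sum is
`1` everywhere on `X`; the support of a function is the set where it does not vanish. Letting the
index types range over the universe of `X` is no restriction, as a locally finite family on `X` has
at most `max (#X) ℵ₀` members that are not identically zero. -/
def IsStrongPPSpace (X : Type u) [TopologicalSpace X] : Prop :=
  ∀ D : Set X, Dense D →
    ∃ (I : ℕ → Type u) (φ : ∀ n, PartitionOfUnity (I n) X) (p : ∀ n, I n → X),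
      (∀ n i, p n i ∈ D) ∧
      ∀ x : X, ∀ U : Set X, IsOpen U → x ∈ U →
        ∃ n₀ : ℕ, ∀ n ≥ n₀, ∀ i : I n, x ∈ Function.support (φ n i) → p n i ∈ U

/-- Co-zero (functionally open) sets. -/
def IsCozeroSet {X : Type u} [TopologicalSpace X] (A : Set X) : Prop :=
  ∃ h : X → ℝ, Continuous h ∧ A = {x | h x ≠ 0}

/-- The Čech-Lebesgue covering dimension of `X` is at most `n`: every finite functionally open cover
of `X` has a finite functionally open refinement (again a cover) of order at most `n`, that is, such
that no point lies in more than `n + 1` of its members. -/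
def CechLebesgueDimLE (X : Type u) [TopologicalSpace X] (n : ℕ) : Prop :=
  ∀ (k : ℕ) (U : Fin k → Set X), (∀ i, IsCozeroSet (U i)) → (⋃ i, U i) = univ →
    ∃ (m : ℕ) (V : Fin m → Set X), (∀ j, IsCozeroSet (V j)) ∧ (⋃ j, V j) = univ ∧
      (∀ j, ∃ i, V j ⊆ U i) ∧ ∀ x : X, {j | x ∈ V j}.ncard ≤ n + 1

/-- `X` is strongly countably dimensional: it is the union of closed sets `F 0, F 1, …` with
`dim (F n) ≤ n`. (Numbered from `1`, this reads `dim X_n < n`.) -/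
def IsStronglyCountablyDimensional (X : Type u) [TopologicalSpace X] : Prop :=
  ∃ F : ℕ → Set X, (∀ n, IsClosed (F n)) ∧ (⋃ n, F n) = univ ∧
    ∀ n, CechLebesgueDimLE (F n) n

/-! ### Baire classes -/

/-! A strong PP-space provides partitions of unity whose sample points lie in the dense set of good
`x` and converge to every `x` at which they are active. The natural approximation of `f (x, y)`
mixes the values of `f (·, y)` at the active sample points, here by iterating `lam`. Without local
convexity such a mixture stays near `f (x, y)` only if the number of steps is bounded independently
of the stage; the bound may depend on `x`. Dimension supplies it: the partitions are refined so that
on `F k` at most `2 * (k + 1)` members are active from some stage on. Bump coverings replace the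
refined covers because some bump equals `1` at each point, and that full step erases the arbitrary
starting point (`exists_nhds_pathFold_mem`). Each approximation has class `α`, by induction on `α`
(`isBaireClass_pathFold`). Since `dim` concerns finite covers only,
`PartitionOfUnity.exists_refinement_card_le` first reduces an arbitrary partition to a countable
cover, each member of which is a disjoint union of small open sets, and then to finite covers on
strips of a continuous function. -/

theorem IsBaireClass.exists_limit {X : Type u} {Y : Type v} [TopologicalSpace X]
    [TopologicalSpace Y] {α : Ordinal.{0}} {f : X → Y} (h : IsBaireClass α f) (hα : 0 < α) :
    ∃ (g : ℕ → X → Y) (ξ : ℕ → Ordinal.{0}), (∀ n, ξ n < α) ∧ (∀ n, IsBaireClass (ξ n) (g n)) ∧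
      ∀ x, Tendsto (fun n => g n x) atTop (𝓝 (f x)) := by
  cases h with
  | zero _ _ => exact absurd hα (lt_irrefl _)
  | limit _ _ _ g ξ hξ hg hlim => exact ⟨g, ξ, hξ, hg, hlim⟩

theorem IsBaireClass.mono {X : Type u} {Y : Type v} [TopologicalSpace X] [TopologicalSpace Y]
    {α β : Ordinal.{0}} {f : X → Y} (h : IsBaireClass α f) (hαβ : α ≤ β) : IsBaireClass β f := by
  rcases hαβ.eq_or_lt with rfl | hlt
  · exact h
  · exact .limit β (bot_le.trans_lt hlt) f (fun _ => f) (fun _ => α) (fun _ => hlt) (fun _ => h)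
      fun _ => tendsto_const_nhds

theorem isBaireClass_zero_iff {X : Type u} {Y : Type v} [TopologicalSpace X] [TopologicalSpace Y]
    {f : X → Y} : IsBaireClass 0 f ↔ Continuous f := by
  refine ⟨fun h => ?_, .zero f⟩
  generalize hα : (0 : Ordinal.{0}) = α at h
  cases h with
  | zero _ hf => exact hf
  | limit _ h0 => exact absurd h0 (hα ▸ lt_irrefl _)

/-- A nonzero countable ordinal has a countable cofinal sequence, which every smaller ordinal
eventually stays below. -/
theorem Ordinal.exists_seq_eventually_ge {α : Ordinal.{0}} (hα : α < ω₁) (h0 : 0 < α) :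
    ∃ ξ : ℕ → Ordinal.{0}, (∀ n, ξ n < α) ∧ ∀ β < α, ∀ᶠ n in atTop, β ≤ ξ n := by
  have : Countable (Iio α) := by
    rw [← Cardinal.mk_le_aleph0_iff, Cardinal.mk_Iio_ordinal, Cardinal.lift_le_aleph0]
    rwa [← Cardinal.lt_aleph_one_iff, ← Cardinal.lt_ord, Cardinal.ord_aleph]
  have : Nonempty (Iio α) := ⟨⟨0, h0⟩⟩
  obtain ⟨e, he⟩ := exists_surjective_nat (Iio α)
  refine ⟨fun n => partialSups e n, fun n => (partialSups e n).2, fun β hβ => ?_⟩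
  obtain ⟨k, hk⟩ := he ⟨β, hβ⟩
  filter_upwards [eventually_ge_atTop k] with n hn
  have := le_partialSups_of_le e hn
  rw [hk] at this
  exact this

/-- Approximations of a Baire function can be delayed so that their classes follow a prescribed
cofinal sequence. -/
theorem IsBaireClass.exists_limit_of_seq {X : Type u} {Y : Type v} [TopologicalSpace X]
    [TopologicalSpace Y] {α : Ordinal.{0}} {f : X → Y} (h : IsBaireClass α f) (hα : 0 < α)
    {ξ : ℕ → Ordinal.{0}} (hξ : ∀ β < α, ∀ᶠ n in atTop, β ≤ ξ n) (y₀ : Y) :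
    ∃ g : ℕ → X → Y, (∀ n, IsBaireClass (ξ n) (g n)) ∧
      ∀ x, Tendsto (fun n => g n x) atTop (𝓝 (f x)) := by
  classical
  obtain ⟨g, ζ, hζ, hg, hlim⟩ := h.exists_limit hα
  -- `Nat.findGreatest` returns `0` when no index qualifies, so the inequality may fail at `k n`;
  -- this happens for finitely many `n` only, and there the constant `y₀` is used.
  let k : ℕ → ℕ := fun n => Nat.findGreatest (fun k => ζ k ≤ ξ n) n
  have hk : Tendsto k atTop atTop := by
    refine tendsto_atTop.2 fun K => ?_
    filter_upwards [hξ _ (hζ K), eventually_ge_atTop K] with n h1 h2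
    exact Nat.le_findGreatest h2 h1
  refine ⟨fun n => if ζ (k n) ≤ ξ n then g (k n) else fun _ => y₀, fun n => ?_, fun x => ?_⟩
  · dsimp only
    split_ifs with hn
    · exact (hg _).mono hn
    · exact (IsBaireClass.zero _ continuous_const).mono bot_le
  · refine ((hlim x).comp hk).congr' ?_
    filter_upwards [hξ _ (hζ 0)] with n hn
    have : ζ (k n) ≤ ξ n := Nat.findGreatest_spec (P := fun k => ζ k ≤ ξ n) (Nat.zero_le n) hn
    simp [this]

/-! ### Folding families of points along a bump covering -/

section Fold

variable {X : Type u} {Y : Type v} {Z : Type w} {J : Type*} [TopologicalSpace X]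
  [TopologicalSpace Y] [TopologicalSpace Z]

/-- Starting from `z₀`, move successively towards the points `z j`, `j ∈ l`, by the amounts
`t j`. -/
def pathFold (lam : Z × Z × unitInterval → Z) (z₀ : Z) (t : J → unitInterval) (z : J → Z)
    (l : List J) : Z :=
  l.foldl (fun h j => lam (h, z j, t j)) z₀

theorem pathFold_filter {lam : Z × Z × unitInterval → Z} (hlam : IsEquiconnected lam) (z₀ : Z)
    (t : J → unitInterval) (z : J → Z) (l : List J) (p : J → Bool)
    (hp : ∀ j ∈ l, p j = false → t j = 0) :
    pathFold lam z₀ t z (l.filter p) = pathFold lam z₀ t z l := by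
  unfold pathFold
  rw [List.foldl_filter]
  refine List.foldl_ext _ _ _ fun h j hj => ?_
  by_cases hpj : p j = true
  · simp [hpj]
  · simp [hpj, hp j hj (by simpa using hpj), hlam.map_zero]

theorem continuous_pathFold {lam : Z × Z × unitInterval → Z} (hlam : IsEquiconnected lam)
    {S : Type*} [TopologicalSpace S] {h : S → Z} (hh : Continuous h) {t : S → J → unitInterval}
    (ht : ∀ j, Continuous fun s => t s j) {z : S → J → Z} (hz : ∀ j, Continuous fun s => z s j)
    (l : List J) : Continuous fun s => pathFold lam (h s) (t s) (z s) l := by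
  induction l generalizing h with
  | nil => exact hh
  | cons j l ih => exact ih (hlam.continuous.comp (hh.prodMk ((hz j).prodMk (ht j))))

/-- Tube lemma: `lam` sends `{(z, z)} × [0, 1]` to `z`, and the interval is compact. -/
theorem IsEquiconnected.exists_nhds_forall_mem {lam : Z × Z × unitInterval → Z}
    (hlam : IsEquiconnected lam) {z : Z} {W : Set Z} (hW : W ∈ 𝓝 z) :
    ∃ V ∈ 𝓝 z, ∀ a ∈ V, ∀ b ∈ V, ∀ t, lam (a, b, t) ∈ W := by
  have key : ∀ᶠ p : Z × Z in 𝓝 (z, z), ∀ t ∈ (univ : Set unitInterval),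
      lam (p.1, p.2, t) ∈ W := by
    refine isCompact_univ.eventually_forall_of_forall_eventually fun t _ => ?_
    have hc : Continuous fun q : (Z × Z) × unitInterval => lam (q.1.1, q.1.2, q.2) :=
      hlam.continuous.comp (by fun_prop)
    exact hc.continuousAt (by simpa [hlam.map_self] using hW)
  rw [nhds_prod_eq] at key
  obtain ⟨V, hV, hVW⟩ := mem_prod_same_iff.1 key
  exact ⟨V, hV, fun a ha b hb t => hVW (mk_mem_prod ha hb) t (mem_univ t)⟩

/-- If the number of steps is bounded, all the points are near `z` and some step is a full one, then
the end point is near `z`, wherever one starts. -/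
theorem exists_nhds_pathFold_mem {lam : Z × Z × unitInterval → Z} (hlam : IsEquiconnected lam)
    (z : Z) (N : ℕ) {W : Set Z} (hW : W ∈ 𝓝 z) :
    ∃ V ∈ 𝓝 z, ∀ (ι : Type u) (z₀ : Z) (t : ι → unitInterval) (p : ι → Z) (l : List ι),
      l.length ≤ N → (∀ j ∈ l, p j ∈ V) → (z₀ ∈ V ∨ ∃ j ∈ l, t j = 1) → pathFold lam z₀ t p l ∈ W := by
  induction N with
  | zero =>
    refine ⟨W, hW, fun ι z₀ t p l hl _ h => ?_⟩
    obtain rfl : l = [] := List.length_eq_zero_iff.1 (Nat.le_zero.1 hl)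
    simpa [pathFold] using h
  | succ N ih =>
    obtain ⟨V, hV, hVW⟩ := ih
    obtain ⟨V', hV', hVV'⟩ := hlam.exists_nhds_forall_mem hV
    have hsub : V' ⊆ V := fun a ha => by simpa [hlam.map_self] using hVV' a ha a ha 0
    refine ⟨V' ∩ W, inter_mem hV' hW, fun ι z₀ t p l hl hp h => ?_⟩
    cases l with
    | nil =>
      have : z₀ ∈ V' ∩ W := by simpa using h
      exact this.2
    | cons j l =>
      have hpj := (hp j (by simp)).1
      refine hVW ι (lam (z₀, p j, t j)) t p l (by simpa using hl)
        (fun i hi => hsub (hp i (by simp [hi])).1) ?_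
      -- After one step the path is in `V`, if it started in `V'` or the step was full; otherwise a
      -- full step is still to come.
      rcases h with h | ⟨i, hi, hti⟩
      · exact .inl (hVV' _ h.1 _ hpj _)
      · rcases List.mem_cons.1 hi with rfl | hi
        · exact .inl (by rw [hti, hlam.map_one]; exact hsub hpj)
        · exact .inr ⟨i, hi, hti⟩

/-- The values at `x` of a bump covering, as points of the unit interval. -/
def BumpCovering.weight (B : BumpCovering J X) (x : X) (j : J) : unitInterval :=
  ⟨B j x, B.nonneg j x, B.le_one j x⟩

theorem BumpCovering.continuous_weight (B : BumpCovering J X) (j : J) :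
    Continuous fun x => B.weight x j :=
  Continuous.subtype_mk (B j).continuous _

theorem BumpCovering.weight_eq_zero {B : BumpCovering J X} {x : X} {j : J} :
    B.weight x j = 0 ↔ B j x = 0 := by
  simp [weight, Subtype.ext_iff]

variable [LinearOrder J]

/-- The indices of the members of a bump covering that do not vanish at `x`, in increasing
order. -/
noncomputable def BumpCovering.activeList (B : BumpCovering J X) (x : X) : List J :=
  (B.point_finite x).toFinset.sort

theorem BumpCovering.mem_activeList {B : BumpCovering J X} {x : X} {j : J} :
    j ∈ B.activeList x ↔ B j x ≠ 0 := by
  simp [activeList]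

/-- Steps of weight `0` do nothing. Hence, by local finiteness, one fixed finite list serves on a
whole neighbourhood. -/
theorem pathFold_activeList {lam : Z × Z × unitInterval → Z} (hlam : IsEquiconnected lam)
    (B : BumpCovering J X) (z₀ : Z) (z : J → Z) {x : X} {S : Finset J}
    (hS : ∀ j, B j x ≠ 0 → j ∈ S) :
    pathFold lam z₀ (B.weight x) z (B.activeList x) = pathFold lam z₀ (B.weight x) z S.sort := by
  classical
  have : B.activeList x = S.sort.filter fun j => B j x ≠ 0 := by
    refine List.Perm.eq_of_pairwise' (r := (· ≤ ·)) (Finset.pairwise_sort _ _)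
      ((Finset.pairwise_sort _ _).filter _) ?_
    refine (List.perm_ext_iff_of_nodup (Finset.sort_nodup _ _)
      ((Finset.sort_nodup _ _).filter _)).2 fun j => ?_
    simp only [Finset.mem_sort, Finite.mem_toFinset, mem_ofPred_eq, List.mem_filter,
      decide_eq_true_eq]
    exact ⟨fun h => ⟨hS j h, h⟩, fun h => h.2⟩
  rw [this]
  refine pathFold_filter hlam _ _ _ _ _ fun j _ hj => ?_
  rw [BumpCovering.weight_eq_zero]
  simpa using hj

/-- For continuous `h j` the fold is locally a finite composition. For larger `α`, all `h j` are
approximated along one common sequence of classes, so that the induction hypothesis applies to every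
stage; such a sequence exists because `α` is countable. -/
theorem isBaireClass_pathFold {lam : Z × Z × unitInterval → Z} (hlam : IsEquiconnected lam)
    (B : BumpCovering J X) (z₀ : Z) {α : Ordinal.{0}} (hα : α < ω₁) {h : J → Y → Z}
    (hh : ∀ j, IsBaireClass α (h j)) :
    IsBaireClass α fun q : X × Y =>
      pathFold lam z₀ (B.weight q.1) (fun j => h j q.2) (B.activeList q.1) := by
  induction α using WellFoundedLT.induction generalizing h with
  | ind α ih =>
    rcases eq_or_lt_of_le (bot_le : 0 ≤ α) with rfl | h0
    · refine .zero _ (continuous_iff_continuousAt.2 fun q => ?_)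
      obtain ⟨U, hU, hfin⟩ := B.locallyFinite q.1
      have hc : Continuous fun q : X × Y =>
          pathFold lam z₀ (B.weight q.1) (fun j => h j q.2) hfin.toFinset.sort :=
        continuous_pathFold hlam continuous_const
          (fun j => (B.continuous_weight j).comp continuous_fst)
          (fun j => (isBaireClass_zero_iff.1 (hh j)).comp continuous_snd) _
      refine hc.continuousAt.congr ?_
      filter_upwards [continuous_fst.continuousAt.preimage_mem_nhds hU] with r hr
      exact (pathFold_activeList hlam B z₀ _ fun j hj => by
        simpa using ⟨r.1, hj, hr⟩).symm
    · obtain ⟨ξ, hξ, hcof⟩ := Ordinal.exists_seq_eventually_ge hα h0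
      choose g hg hlim using fun j => (hh j).exists_limit_of_seq h0 hcof z₀
      refine .limit α h0 _ (fun n q => pathFold lam z₀ (B.weight q.1) (fun j => g j n q.2)
        (B.activeList q.1)) ξ hξ (fun n => ih _ (hξ n) ((hξ n).trans hα) fun j => hg j n)
        fun q => ?_
      -- At a fixed `q` the list and the weights are fixed, so pointwise limits pass through the
      -- fold.
      have hc : Continuous fun z : J → Z =>
          pathFold lam z₀ (B.weight q.1) z (B.activeList q.1) :=
        continuous_pathFold hlam (h := fun _ => z₀) continuous_const
          (t := fun _ => B.weight q.1) (fun _ => continuous_const) (z := fun z => z)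
          (fun j => continuous_apply j) _
      exact (hc.tendsto _).comp (tendsto_pi_nhds.2 fun j => hlim j q.2)

end Fold

/-! ### Refinements of bounded order on finite-dimensional closed subsets -/

/-- For a partition of unity `ρ`, the set of the points at which the members of `ρ` with indices in
`T` exceed some positive threshold and the other members are below it. -/
def PartitionOfUnity.dominated {I X : Type*} [TopologicalSpace X] (ρ : PartitionOfUnity I X)
    (T : Finset I) : Set X :=
  {x | ∃ c > 0, (∀ i ∈ T, c < ρ i x) ∧ ∀ i ∉ T, ρ i x < c}

/-- The same threshold works nearby: all but finitely many members vanish there, and `0 < c`. -/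
theorem PartitionOfUnity.isOpen_dominated {I X : Type*} [TopologicalSpace X]
    (ρ : PartitionOfUnity I X) (T : Finset I) : IsOpen (ρ.dominated T) := by
  classical
  refine isOpen_iff_mem_nhds.2 fun x => ?_
  rintro ⟨c, hc, hT, hT'⟩
  obtain ⟨U, hU, hfin⟩ := ρ.locallyFinite x
  have h1 : ∀ᶠ y in 𝓝 x, ∀ i ∈ T, c < ρ i y := (Finset.eventually_all T).2 fun i hi =>
    (ρ i).continuous.continuousAt.eventually (lt_mem_nhds (hT i hi))
  have h2 : ∀ᶠ y in 𝓝 x, ∀ i ∈ hfin.toFinset.filter (· ∉ T), ρ i y < c :=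
    (Finset.eventually_all _).2 fun i hi =>
      (ρ i).continuous.continuousAt.eventually (gt_mem_nhds (hT' i (Finset.mem_filter.1 hi).2))
  filter_upwards [hU, h1, h2] with y hy hy1 hy2
  refine ⟨c, hc, hy1, fun i hi => ?_⟩
  by_cases h0 : ρ i y = 0
  · rwa [h0]
  · exact hy2 i (Finset.mem_filter.2 ⟨hfin.mem_toFinset.2 ⟨y, h0, hy⟩, hi⟩)

/-- Two dominating sets at one point are nested, as superlevel sets of `i ↦ ρ i x`; equal
cardinality makes them equal. -/
theorem PartitionOfUnity.eq_of_mem_dominated {I X : Type*} [TopologicalSpace X]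
    {ρ : PartitionOfUnity I X} {S T : Finset I} {x : X} (hS : x ∈ ρ.dominated S)
    (hT : x ∈ ρ.dominated T) (hcard : S.card = T.card) : S = T := by
  obtain ⟨c, -, hS, hS'⟩ := hS
  obtain ⟨d, -, hT, hT'⟩ := hT
  by_contra hne
  have h1 : ¬ S ⊆ T := fun h => hne (Finset.eq_of_subset_of_card_le h hcard.ge)
  have h2 : ¬ T ⊆ S := fun h => hne (Finset.eq_of_subset_of_card_le h hcard.le).symm
  obtain ⟨i, hiS, hiT⟩ := Finset.not_subset.1 h1
  obtain ⟨j, hjT, hjS⟩ := Finset.not_subset.1 h2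
  linarith [hS i hiS, hT' i hiT, hT j hjT, hS' j hjS]

theorem PartitionOfUnity.exists_mem_dominated {I X : Type*} [TopologicalSpace X]
    (ρ : PartitionOfUnity I X) (x : X) : ∃ T : Finset I, T.Nonempty ∧ x ∈ ρ.dominated T := by
  classical
  obtain ⟨i₀, hi₀⟩ := ρ.exists_pos (mem_univ x)
  have hfin : {i | ρ i x ≠ 0}.Finite := ρ.locallyFinite.point_finite x
  have hT : ∀ i, i ∈ hfin.toFinset.filter (fun i => ρ i₀ x ≤ ρ i x) ↔ ρ i₀ x ≤ ρ i x := by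
    intro i
    simp only [Finset.mem_filter, Finite.mem_toFinset, and_iff_right_iff_imp]
    exact fun h => (hi₀.trans_le h).ne'
  -- The threshold is slightly below `ρ i₀ x`, above the finitely many smaller values.
  obtain ⟨d, hd, hd0, hdi⟩ : ∃ d < ρ i₀ x, 0 < d ∧ ∀ i, ρ i x < ρ i₀ x → ρ i x < d := by
    have : ∀ᶠ d in 𝓝[<] (ρ i₀ x), ∀ i ∈ hfin.toFinset, ρ i x < ρ i₀ x → ρ i x < d := by
      refine (Finset.eventually_all _).2 fun i _ => ?_
      by_cases hi : ρ i x < ρ i₀ x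
      · filter_upwards [nhdsWithin_le_nhds (lt_mem_nhds hi)] with d hd _ using hd
      · exact .of_forall fun d h => absurd h hi
    obtain ⟨d, h1, h2, h3⟩ := (this.and ((eventually_nhdsWithin_of_eventually_nhds
      (lt_mem_nhds hi₀)).and self_mem_nhdsWithin)).exists
    refine ⟨d, h3, h2, fun i hi => ?_⟩
    by_cases h0 : ρ i x = 0
    · rwa [h0]
    · exact h1 i (hfin.mem_toFinset.2 h0) hi
  exact ⟨_, ⟨i₀, (hT i₀).2 le_rfl⟩, d, hd0, fun i hi => hd.trans_le ((hT i).1 hi),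
    fun i hi => hdi i (not_le.1 fun h => hi ((hT i).2 h))⟩

section Dim

variable {X : Type u} [TopologicalSpace X] [T2Space X] [ParacompactSpace X]

theorem exists_shrinking_card_le {n k : ℕ} {U : Fin n → Set X} (hU : ∀ i, IsOpen (U i))
    (hcov : ⋃ i, U i = univ) {F : Set X} (hF : IsClosed F) (hdim : CechLebesgueDimLE F k) :
    ∃ V : Fin n → Set X, (∀ i, IsOpen (V i)) ∧ ⋃ i, V i = univ ∧ (∀ i, V i ⊆ U i) ∧
      ∀ x ∈ F, ∀ S : Finset (Fin n), (∀ i ∈ S, x ∈ V i) → S.card ≤ k + 1 := by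
  classical
  -- The bumps turn the open cover into the co-zero cover that the definition of dimension requires.
  obtain ⟨B, hB⟩ := BumpCovering.exists_isSubordinate isClosed_univ U hU hcov.ge
  obtain ⟨m, C, hC, hCcov, hCsub, hCcard⟩ := hdim n (fun i => {x : F | B i x ≠ 0})
    (fun i => ⟨fun x => B i x, by fun_prop, rfl⟩) (eq_univ_of_forall fun x => mem_iUnion.2
      ⟨B.ind x (mem_univ _), by simp [B.ind_apply]⟩)
  choose a ha using hCsub
  have hopen : ∀ j, ∃ O : Set X, IsOpen O ∧ ∀ x : F, (x : X) ∈ O ↔ x ∈ C j := by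
    intro j
    obtain ⟨h, hh, hj⟩ := hC j
    obtain ⟨O, hO, hOC⟩ := isOpen_induced_iff.1
      (hj ▸ isOpen_ne_fun hh continuous_const : IsOpen (C j))
    exact ⟨O, hO, fun x => by rw [← hOC]; rfl⟩
  choose O hO hOC using hopen
  -- Refining sets assigned to the same `i` are merged, which cannot raise the order; off `F`
  -- nothing is removed.
  refine ⟨fun i => U i ∩ ((⋃ j, ⋃ _ : a j = i, O j) ∪ Fᶜ), fun i => (hU i).inter
    ((isOpen_iUnion fun j => isOpen_iUnion fun _ => hO j).union hF.isOpen_compl), ?_,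
    fun i => inter_subset_left, fun x hx S hS => ?_⟩
  · refine eq_univ_of_forall fun x => mem_iUnion.2 ?_
    by_cases hx : x ∈ F
    · obtain ⟨j, hj⟩ := mem_iUnion.1 (hCcov.ge (mem_univ (⟨x, hx⟩ : F)))
      refine ⟨a j, hB _ (subset_tsupport _ (ha j hj)), .inl ?_⟩
      simp only [mem_iUnion]
      exact ⟨j, rfl, (hOC j ⟨x, hx⟩).2 hj⟩
    · obtain ⟨i, hi⟩ := mem_iUnion.1 (hcov.ge (mem_univ x))
      exact ⟨i, hi, .inr hx⟩
  · have hsub : (S : Set (Fin n)) ⊆ a '' {j | (⟨x, hx⟩ : F) ∈ C j} := by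
      intro i hi
      rcases (hS i hi).2 with h | h
      · simp only [mem_iUnion] at h
        obtain ⟨j, hji, hj⟩ := h
        exact ⟨j, (hOC j ⟨x, hx⟩).1 hj, hji⟩
      · exact absurd hx h
    calc S.card = (S : Set (Fin n)).ncard := (ncard_coe_finset S).symm
      _ ≤ (a '' {j | (⟨x, hx⟩ : F) ∈ C j}).ncard := ncard_le_ncard hsub (toFinite _)
      _ ≤ _ := ncard_image_le (toFinite _)
      _ ≤ k + 1 := hCcard _

/-- Shrinking for one `F k` after another works because further shrinking preserves the earlier
bounds. -/
theorem exists_shrinking_card_le_forall_lt {F : ℕ → Set X} (hF : ∀ k, IsClosed (F k))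
    (hdim : ∀ k, CechLebesgueDimLE (F k) k) (m : ℕ) {n : ℕ} {U : Fin n → Set X}
    (hU : ∀ i, IsOpen (U i)) (hcov : ⋃ i, U i = univ) :
    ∃ V : Fin n → Set X, (∀ i, IsOpen (V i)) ∧ ⋃ i, V i = univ ∧ (∀ i, V i ⊆ U i) ∧
      ∀ k < m, ∀ x ∈ F k, ∀ S : Finset (Fin n), (∀ i ∈ S, x ∈ V i) → S.card ≤ k + 1 := by
  induction m with
  | zero => exact ⟨U, hU, hcov, fun i => subset_rfl, fun k hk => absurd hk (Nat.not_lt_zero k)⟩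
  | succ m ih =>
    obtain ⟨V, hV, hVcov, hVU, hcard⟩ := ih
    obtain ⟨V', hV', hVcov', hVV', hcard'⟩ := exists_shrinking_card_le hV hVcov (hF m) (hdim m)
    refine ⟨V', hV', hVcov', fun i => (hVV' i).trans (hVU i), fun k hk x hx S hS => ?_⟩
    rcases Nat.lt_succ_iff_lt_or_eq.1 hk with hk | rfl
    · exact hcard k hk x hx S fun i hi => hVV' i (hS i hi)
    · exact hcard' x hx S hS

/-- A countable open cover is dominated by a continuous function: below height `n`, the members
with index less than `n` suffice. -/
theorem exists_continuous_lt_imp_exists_mem {W : ℕ → Set X} (hW : ∀ n, IsOpen (W n))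
    (hcov : ⋃ n, W n = univ) :
    ∃ g : X → ℝ, Continuous g ∧ (∀ x, 0 ≤ g x) ∧ ∀ x (n : ℕ), g x < n → ∃ j < n, x ∈ W j := by
  obtain ⟨ρ, hρ⟩ := PartitionOfUnity.exists_isSubordinate isClosed_univ W hW hcov.ge
  -- The value at `x` is an average of indices `j` with `x ∈ W j`; if all of these are at least `n`,
  -- so is the average.
  refine ⟨fun x => ∑ᶠ j, ρ j x • (j : ℝ),
    ρ.continuous_finsum_smul fun _ _ _ => continuousAt_const,
    fun x => finsum_nonneg fun j => mul_nonneg (ρ.nonneg j x) (Nat.cast_nonneg j),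
    fun x n hx => ?_⟩
  by_contra! hcon
  have hzero : ∀ j < n, ρ j x = 0 := fun j hj => by
    by_contra h
    exact hcon j hj (hρ j (subset_tsupport _ h))
  dsimp only at hx
  rw [← ρ.sum_finsupport_smul_eq_finsum (fun j _ => (j : ℝ))] at hx
  refine hx.not_ge ?_
  calc (n : ℝ) = ∑ j ∈ ρ.finsupport x, ρ j x * n := by
        rw [← Finset.sum_mul, ρ.sum_finsupport (mem_univ x), one_mul]
    _ ≤ ∑ j ∈ ρ.finsupport x, ρ j x • (j : ℝ) := by
        refine Finset.sum_le_sum fun j _ => ?_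
        by_cases hj : j < n
        · simp [hzero j hj]
        · exact mul_le_mul_of_nonneg_left (by exact_mod_cast not_lt.1 hj) (ρ.nonneg j x)

/-- In the bound, `k + 1` comes from a finite cover of order at most `k` on `F k`, and `2` from the
overlap of the strips `E n`. -/
theorem PartitionOfUnity.exists_refinement_card_le {F : ℕ → Set X} (hF : ∀ k, IsClosed (F k))
    (hdim : ∀ k, CechLebesgueDimLE (F k) k) (m : ℕ) {I : Type v} (ρ : PartitionOfUnity I X) :
    ∃ (J : Type v) (V : J → Set X) (a : J → I), (∀ j, IsOpen (V j)) ∧ ⋃ j, V j = univ ∧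
      (∀ j, V j ⊆ Function.support (ρ (a j))) ∧
      ∀ k < m, ∀ x ∈ F k, ∀ S : Finset J, (∀ j ∈ S, x ∈ V j) → S.card ≤ (k + 1) * 2 := by
  classical
  let W : ℕ → Set X := fun n => ⋃ T : {T : Finset I // T.Nonempty ∧ T.card = n}, ρ.dominated T
  have hW : ∀ n, IsOpen (W n) := fun n => isOpen_iUnion fun T => ρ.isOpen_dominated T
  have hWcov : ⋃ n, W n = univ := eq_univ_of_forall fun x => by
    obtain ⟨T, hT, hx⟩ := ρ.exists_mem_dominated x
    exact mem_iUnion.2 ⟨T.card, mem_iUnion.2 ⟨⟨T, hT, rfl⟩, hx⟩⟩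
  obtain ⟨g, hg, hg0, hgW⟩ := exists_continuous_lt_imp_exists_mem hW hWcov
  -- On the strip `E n` one has `g < n + 1`, so `W 0, …, W (n + 1)` cover it. The last member, of
  -- index `n + 2`, completes the cover of `X` and misses the strip.
  let U : ∀ n : ℕ, Fin (n + 3) → Set X := fun n j =>
    if (j : ℕ) < n + 2 then W j else {x | (n + 1 : ℝ) < g x}
  have hU : ∀ n j, IsOpen (U n j) := fun n j => by
    dsimp only [U]
    split_ifs
    · exact hW j
    · exact isOpen_lt continuous_const hg
  have hUcov : ∀ n, ⋃ j, U n j = univ := fun n => eq_univ_of_forall fun x => by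
    by_cases hx : (n + 1 : ℝ) < g x
    · exact mem_iUnion.2 ⟨Fin.last _, by simpa [U] using hx⟩
    · obtain ⟨j, hj, hxj⟩ := hgW x (n + 2) (by push_cast; linarith)
      exact mem_iUnion.2 ⟨⟨j, hj.trans (Nat.lt_succ_self _)⟩, by simpa [U, hj] using hxj⟩
  choose C hC hCcov hCU hCcard using fun n =>
    exists_shrinking_card_le_forall_lt hF hdim m (hU n) (hUcov n)
  let E : ℕ → Set X := fun n => {x | (n : ℝ) < g x + 1 ∧ g x < n + 1}
  let V : ℕ × {T : Finset I // T.Nonempty} → Set X := fun q =>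
    {x | x ∈ E q.1 ∧ (∃ h : q.2.1.card < q.1 + 3, x ∈ C q.1 ⟨q.2.1.card, h⟩) ∧
      x ∈ ρ.dominated q.2.1}
  refine ⟨ℕ × {T : Finset I // T.Nonempty}, V, fun q => q.2.2.choose, fun q => ?_, ?_, ?_, ?_⟩
  · have : V q = E q.1 ∩ ((⋃ h : q.2.1.card < q.1 + 3, C q.1 ⟨q.2.1.card, h⟩) ∩
        ρ.dominated q.2.1) := by
      ext x
      simp only [V, mem_inter_iff, mem_iUnion, mem_ofPred_eq]
    rw [this]
    exact ((isOpen_lt continuous_const (hg.add continuous_const)).inter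
      (isOpen_lt hg continuous_const)).inter
      ((isOpen_iUnion fun _ => hC _ _).inter (ρ.isOpen_dominated _))
  · refine eq_univ_of_forall fun x => mem_iUnion.2 ?_
    have hE : x ∈ E ⌊g x⌋₊ :=
      ⟨(Nat.floor_le (hg0 x)).trans_lt (lt_add_one _), Nat.lt_floor_add_one _⟩
    obtain ⟨j, hj⟩ := mem_iUnion.1 ((hCcov ⌊g x⌋₊).ge (mem_univ x))
    have hxU := hCU _ _ hj
    dsimp only [U] at hxU
    split_ifs at hxU with h
    · obtain ⟨⟨T, hT, hTj⟩, hxT⟩ := mem_iUnion.1 hxU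
      refine ⟨(⌊g x⌋₊, ⟨T, hT⟩), hE, ⟨hTj ▸ j.2, ?_⟩, hxT⟩
      convert hj
    · exact absurd hxU (not_lt.2 hE.2.le)
  · rintro ⟨n, T⟩ x ⟨-, -, c, hc, hT, -⟩
    exact (hc.trans (hT _ T.2.choose_spec)).ne'
  · intro k hk x hx S hS
    refine (Finset.card_le_mul_card_image (f := Prod.fst) S (k + 1) fun n _ => ?_).trans
      (Nat.mul_le_mul_left _ ?_)
    · have hmem : ∀ q ∈ S.filter (fun q => q.1 = n), q.1 = n ∧ x ∈ V q := fun q hq =>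
        ⟨(Finset.mem_filter.1 hq).2, hS q (Finset.mem_filter.1 hq).1⟩
      let e : ℕ × {T : Finset I // T.Nonempty} → Fin (n + 3) := fun q =>
        if h : q.2.1.card < n + 3 then ⟨q.2.1.card, h⟩ else 0
      -- Within one strip, the members containing `x` are told apart by the cardinality of `T`, so
      -- the order of the finite cover `C n` bounds their number.
      have hinj : Set.InjOn e (S.filter fun q => q.1 = n) := by
        intro q hq r hr hqr
        obtain ⟨hqn, -, ⟨hq1, -⟩, hqx⟩ := hmem q hq
        obtain ⟨hrn, -, ⟨hr1, -⟩, hrx⟩ := hmem r hr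
        rw [hqn] at hq1
        rw [hrn] at hr1
        simp only [e, hq1, hr1, dif_pos, Fin.mk.injEq] at hqr
        exact Prod.ext (hqn.trans hrn.symm)
          (Subtype.ext (PartitionOfUnity.eq_of_mem_dominated hqx hrx hqr))
      rw [← Finset.card_image_of_injOn hinj]
      refine hCcard n k hk x hx _ fun i hi => ?_
      obtain ⟨q, hq, rfl⟩ := Finset.mem_image.1 hi
      obtain ⟨rfl, -, ⟨hq1, hqC⟩, -⟩ := hmem q hq
      simpa only [e, hq1, dif_pos] using hqC
    -- `x ∈ E n` means `n - 1 < g x < n + 1`, which leaves two values of `n`.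
    · refine (Finset.card_le_card (t := {⌊g x⌋₊, ⌊g x⌋₊ + 1}) fun n hn => ?_).trans
        Finset.card_le_two
      obtain ⟨q, hq, rfl⟩ := Finset.mem_image.1 hn
      obtain ⟨⟨h1, h2⟩, -⟩ := hS q hq
      have h3 : ⌊g x⌋₊ < q.1 + 1 := (Nat.floor_lt (hg0 x)).2 (by push_cast; exact h2)
      have h4 : q.1 < ⌊g x⌋₊ + 2 := by
        have := Nat.lt_floor_add_one (g x)
        have h5 : (q.1 : ℝ) < (⌊g x⌋₊ + 2 : ℕ) := by push_cast; linarith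
        exact_mod_cast h5
      simp only [Finset.mem_insert, Finset.mem_singleton]
      omega

end Dim

/-! ### The approximating sequence and its convergence -/

theorem mainTheorem2 {X : Type u} {Y : Type v} {Z : Type w}
    [TopologicalSpace X] [TopologicalSpace Y] [TopologicalSpace Z]
    [T2Space X] [ParacompactSpace X]
    (hX : IsStronglyCountablyDimensional X) (hPP : IsStrongPPSpace X)
    (lam : Z × Z × unitInterval → Z) (hlam : IsEquiconnected lam)
    (α : Ordinal.{0}) (hα : α < ω₁) :
    IsRudinTriple α X Y Z := by
  rintro f ⟨hcont, hdense⟩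
  rcases isEmpty_or_nonempty (X × Y) with hempty | ⟨⟨q₀⟩⟩
  · exact (IsBaireClass.zero f (continuous_iff_continuousAt.2 fun q => hempty.elim q)).mono bot_le
  obtain ⟨F, hF, hFcov, hdim⟩ := hX
  obtain ⟨I, φ, p, hpD, hp⟩ := hPP _ hdense
  choose J V a hV hVcov hVsub hVcard using fun n => (φ n).exists_refinement_card_le hF hdim n
  choose B hB using fun n => BumpCovering.exists_isSubordinate isClosed_univ (V n) (hV n)
    (hVcov n).ge
  classical
  let _ (n : ℕ) : LinearOrder (J n) := linearOrderOfSTO WellOrderingRel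
  refine .limit (α + 1) (by simp) f (fun n q => pathFold lam (f q₀) ((B n).weight q.1)
    (fun j => f (p n (a n j), q.2)) ((B n).activeList q.1)) (fun _ => α)
    (fun _ => by simp)
    (fun n => isBaireClass_pathFold hlam (B n) _ hα fun j => hpD n (a n j)) ?_
  rintro ⟨x, y⟩
  obtain ⟨k, hk⟩ := mem_iUnion.1 (hFcov.ge (mem_univ x))
  refine tendsto_def.2 fun W hW => ?_
  obtain ⟨G, hG, hGW⟩ := exists_nhds_pathFold_mem hlam (f (x, y)) ((k + 1) * 2) hW
  obtain ⟨O, hOG, hO, hxO⟩ := mem_nhds_iff.1 ((hcont y).continuousAt hG)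
  obtain ⟨n₀, hn₀⟩ := hp x O hO hxO
  -- `n ≥ n₀` brings the active sample points into `O`; `n > k` is needed because the `n`-th cover
  -- has bounded order only on the `F k` with `k < n`.
  filter_upwards [eventually_ge_atTop n₀, eventually_gt_atTop k] with n hn hkn
  have hxV : ∀ j, B n j x ≠ 0 → x ∈ V n j := fun j hj => hB n j (subset_tsupport _ hj)
  refine hGW _ _ _ _ _ ?_ (fun j hj => ?_) (.inr ⟨(B n).ind x (mem_univ x), ?_, ?_⟩)
  · rw [BumpCovering.activeList, Finset.length_sort]
    exact hVcard n k hkn x hk _ fun j hj => hxV j (by simpa using hj)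
  · exact hOG (hn₀ n hn _ (hVsub n j (hxV j (BumpCovering.mem_activeList.1 hj))))
  · rw [BumpCovering.mem_activeList, BumpCovering.ind_apply]
    exact one_ne_zero
  · exact Subtype.ext ((B n).ind_apply x (mem_univ x))
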